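/- **Setting.** Let $E$ be a finite-dimensional real inner product space, $K\subseteq E$ a closed convex cone, $c\in E$, $\mathcal A:E\to\mathbb R^m$ linear with adjoint $\mathcal A^T$, and consider the problem (D) of maximizing $\langle b,y\rangle$ subject to $c-\mathcal A^Ty\in K$. The *generic facial reduction algorithm* starts with $\mathcal F_1=K$, $i=1$. At step $i$ it picks some $d_i\in\mathcal F_i^*\cap\ker\mathcal A$ such that either (i) $d_i\notin\mathcal F_i^\perp$ and $\langle c,d_i\rangle=0$, or (ii) $\langle c,d_i\rangle<0$; if there is no such $d_i$, it stops with the directions $d_1,\dots,d_{i-1}$. In case (ii) it stops with the directions $d_1,\dots,d_i$ (the problem is infeasible). In case (i) it sets $\mathcal F_{i+1}=\mathcal F_i\cap\{d_i\}^\perp$ and continues with $i+1$. The *singularity degree* $d(D)$ is the minimum number of directions over all possible outputs. The *distance to polyhedrality* $\ell_{\rm poly}(K)$ is the length minus one of a longest chain $\mathcal G_1\subsetneq\dots\subsetneq\mathcal G_\ell$ of nonempty faces of $K$ such that $\mathcal G_1$ is polyhedral and $\mathcal G_j$ is not polyhedral for $j>1$. Let $\mathcal Q_t=\{(x_0,\bar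 x)\in\mathbb R\times\mathbb R^{t-1}: \|\bar x\|_2\le x_0\}$ be the Lorentz cone and $\mathcal S^n_+$ the cone of positive semidefinite matrices in the space $\mathcal S^n$ of real symmetric $n\times n$ matrices with $\langle X,Y\rangle=\operatorname{tr}(XY)$. Let $r_1+r_2>0$, $t_j\ge3$, $n_j\ge 3$ for all $j$, and $$K=\mathcal Q_{t_1}\times\dots\times\mathcal Q_{t_{r_1}}\times\mathcal S^{n_1}_+\times\dots\times\mathcal S^{n_{r_2}}_+ .$$ In the ambient space $\prod_j\mathbb R^{t_j}\times\prod_j\mathcal S^{n_j}$ let $a^j_i$ $(1\le j\le r_1)$ be the element whose $j$-th Lorentz block is the $i$-th unit vector and whose other blocks are zero, and let $a^j_{i,k}$ $(1\le j\le r_2)$ be the element whose $j$-th matrix block has ones at the positions $(i,k)$ and $(k,i)$ and zeros elsewhere, and whose other blocks are zero. Let $\mathcal L^\perp$ be the span of the following vectors, and $\mathcal L$ its orthogonal complement: 1. if $r_1>0$: $a^1_1+a^1_2$, and $a^{j-1}_3+a^j_1+a^j_2$ for $1<j\le r_1$; 2. if $r_2>0$: $a^{r_1}_3+a^1_{1,1}$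 (if $r_1=0$, use $a^1_{1,1}$ instead), and $a^1_{i,i}+a^1_{i-1,i+1}$ for $1<i<n_1$; 3. for $1<j\le r_2$: $a^{j-1}_{n_{j-1},\,n_{j-1}-1}+a^j_{1,1}$, and $a^j_{i,i}+a^j_{i-1,i+1}$ for $1<i<n_j$. **Proposition.** Consider (D) with this $K$, with $c=0$, and with any $\mathcal A$ such that $\operatorname{range}\mathcal A^T=\mathcal L$. Then $$d(D)=r_1+\sum_{j=1}^{r_2}(n_j-1).$$ Consequently the worst-case bound $1+\sum_{j=1}^{r_1}\ell_{\rm poly}(\mathcal Q_{t_j})+\sum_{j=1}^{r_2}\ell_{\rm poly}(\mathcal S^{n_j}_+)$ on the number of facial reduction steps for problems over $K$ is off by at most one: it is equal to $d(D)+1$. -/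

import Mathlib

open scoped RealInnerProductSpace

noncomputable section

/-! ### Facial reduction and the singularity degree -/

section General

variable {E : Type*} [NormedAddCommGroup E] [InnerProductSpace ℝ E] {m : ℕ}

/-- `d` is a reducing direction of type (i) at the cone `F`, for the feasible slacks
`c - range Aᵀ`: `d ∈ F* ∩ ker A`, `d ∉ F^⊥` and `⟪c, d⟫ = 0`. -/
def IsReducingDirection (c : E) (A : E →ₗ[ℝ] EuclideanSpace ℝ (Fin m))
    (F : PointedCone ℝ E) (d : E) : Prop :=
  d ∈ PointedCone.dual (innerₗ E) (F : Set E) ∧ A d = 0 ∧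
    d ∉ (Submodule.span ℝ (F : Set E))ᗮ ∧ ⟪c, d⟫ = 0

/-- `d` is an infeasibility certificate (a direction of type (ii)) at the cone `F`:
`d ∈ F* ∩ ker A` and `⟪c, d⟫ < 0`. -/
def IsInfeasibilityCertificate (c : E) (A : E →ₗ[ℝ] EuclideanSpace ℝ (Fin m))
    (F : PointedCone ℝ E) (d : E) : Prop :=
  d ∈ PointedCone.dual (innerₗ E) (F : Set E) ∧ A d = 0 ∧ ⟪c, d⟫ < 0

/-- The cone `F ∩ {d}^⊥`. -/
def cutByOrthogonal (F : PointedCone ℝ E) (d : E) : PointedCone ℝ E :=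
  F ⊓ ((ℝ ∙ d)ᗮ : Submodule ℝ E)

/-- `IsFacialReductionOutput c A F ds` says that the generic facial reduction algorithm, started
at the cone `F`, can output exactly the sequence of directions `ds`. -/
inductive IsFacialReductionOutput (c : E) (A : E →ₗ[ℝ] EuclideanSpace ℝ (Fin m)) :
    PointedCone ℝ E → List E → Prop
  | finish (F : PointedCone ℝ E)
      (h : ∀ d, ¬ IsReducingDirection c A F d ∧ ¬ IsInfeasibilityCertificate c A F d) :
      IsFacialReductionOutput c A F []
  | infeasible (F : PointedCone ℝ E) (d : E) (h : IsInfeasibilityCertificate c A F d) :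
      IsFacialReductionOutput c A F [d]
  | step (F : PointedCone ℝ E) (d : E) (ds : List E) (h : IsReducingDirection c A F d)
      (hds : IsFacialReductionOutput c A (cutByOrthogonal F d) ds) :
      IsFacialReductionOutput c A F (d :: ds)

/-- The singularity degree of the problem `sup ⟪b, y⟫` subject to `c - Aᵀ y ∈ K` (it does not
depend on `b`): the minimum number of directions among all the possible outputs of the generic
facial reduction algorithm (`⊤` if there is no output). -/
def singularityDegree (K : PointedCone ℝ E) (c : E)
    (A : E →ₗ[ℝ] EuclideanSpace ℝ (Fin m)) : ℕ∞ :=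
  ⨅ (ds : List E) (_ : IsFacialReductionOutput c A K ds), (ds.length : ℕ∞)

/-- A cone is polyhedral if it is the intersection of finitely many half-spaces
`{x | 0 ≤ ⟪a, x⟫}`. -/
def IsPolyhedralCone (F : PointedCone ℝ E) : Prop :=
  PointedCone.DualFG (innerₗ E) F

/-- The distance to polyhedrality of `K`: the length minus one (the number of strict inclusions)
of a longest chain `F₁ ⊊ ⋯ ⊊ F_ℓ` of nonempty faces of `K` such that `F₁` is polyhedral and `F_j`
is not polyhedral for `j > 1`. (The nonempty faces of a cone are themselves pointed cones.) -/
def distPoly (K : PointedCone ℝ E) : ℕ∞ :=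
  ⨆ (F : LTSeries (PointedCone ℝ E))
    (_ : (∀ i, (F i).IsFaceOf K) ∧ IsPolyhedralCone (F 0) ∧ ∀ i, i ≠ 0 → ¬ IsPolyhedralCone (F i)),
    (F.length : ℕ∞)

end General

/-! ### Lorentz cones and cones of positive semidefinite matrices -/

/-- The space `ℝ × ℝ^(t-1)` with the Euclidean inner product, for `t ≥ 1`. -/
abbrev LorentzSpace (t : ℕ) : Type := WithLp 2 (ℝ × EuclideanSpace ℝ (Fin (t - 1)))

/-- The Lorentz cone `{(x₀, x̄) ∈ ℝ × ℝ^(t-1) | ‖x̄‖ ≤ x₀}`. -/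
def lorentzCone (t : ℕ) : PointedCone ℝ (LorentzSpace t) where
  carrier := {x | ‖x.snd‖ ≤ x.fst}
  add_mem' := by
    intro x y hx hy
    simp only [Set.mem_ofPred_eq, WithLp.add_fst, WithLp.add_snd] at *
    exact (norm_add_le _ _).trans (add_le_add hx hy)
  zero_mem' := by simp
  smul_mem' := by
    rintro ⟨a, ha⟩ x hx
    simp only [Set.mem_ofPred_eq] at *
    change ‖a • x.snd‖ ≤ a * x.fst
    rw [norm_smul, Real.norm_of_nonneg ha]
    exact mul_le_mul_of_nonneg_left hx ha

/-- The `i`-th unit vector of `ℝ × ℝ^(t-1) = ℝ^t`, for `i = 1, …, t`. -/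
def lorentzUnit (t i : ℕ) : LorentzSpace t :=
  WithLp.toLp 2 (if i = 1 then 1 else 0, WithLp.toLp 2 fun k => if (k : ℕ) + 2 = i then 1 else 0)

/-- The real symmetric `n × n` matrices, as a subspace of the space of families
`(X_{pq})_{p,q}` with its Euclidean inner product `⟪X, Y⟫ = ∑ p q, X_{pq} Y_{pq} = tr (X Y)`. -/
def symSubmodule (n : ℕ) : Submodule ℝ (EuclideanSpace ℝ (Fin n × Fin n)) where
  carrier := {X | ∀ p q, X (p, q) = X (q, p)}
  add_mem' := by
    intro X Y hX hY p q
    simp [hX p q, hY p q]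
  zero_mem' := by simp
  smul_mem' := by
    intro a X hX p q
    simp [hX p q]

/-- The Euclidean space of real symmetric `n × n` matrices. -/
abbrev SymSpace (n : ℕ) : Type := symSubmodule n

/-- An element of `SymSpace n` as a matrix. -/
def SymSpace.toMatrix {n : ℕ} (X : SymSpace n) : Matrix (Fin n) (Fin n) ℝ :=
  Matrix.of fun p q => (X : EuclideanSpace ℝ (Fin n × Fin n)) (p, q)

/-- The cone of symmetric positive semidefinite `n × n` matrices. -/
def psdCone (n : ℕ) : PointedCone ℝ (SymSpace n) where
  carrier := {X | X.toMatrix.PosSemidef}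
  add_mem' := fun hX hY => Matrix.PosSemidef.add hX hY
  zero_mem' := Matrix.PosSemidef.zero
  smul_mem' := fun a _ hX => Matrix.PosSemidef.smul hX a.2

/-- The symmetric matrix with entry one at the positions `(i, k)` and `(k, i)` and zero elsewhere,
where rows and columns are numbered from `1` to `n`. -/
def symUnit (n i k : ℕ) : SymSpace n :=
  ⟨WithLp.toLp 2 fun pq =>
    if ((pq.1 : ℕ) + 1 = i ∧ (pq.2 : ℕ) + 1 = k) ∨ ((pq.1 : ℕ) + 1 = k ∧ (pq.2 : ℕ) + 1 = i)
    then 1 else 0, by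
    intro p q
    simp only
    congr 1
    exact propext (by tauto)⟩

/-! ### The product cone and the instance -/

variable {r₁ r₂ : ℕ}

/-- The Euclidean space `ℝ^{t_1} × ⋯ × ℝ^{t_{r₁}} × S^{n_1} × ⋯ × S^{n_{r₂}}`. -/
def ProductSpace (t : Fin r₁ → ℕ) (n : Fin r₂ → ℕ) : Type :=
  WithLp 2 (PiLp 2 (fun j => LorentzSpace (t j)) × PiLp 2 (fun j => SymSpace (n j)))

namespace ProductSpace

variable {t : Fin r₁ → ℕ} {n : Fin r₂ → ℕ}

instance : NormedAddCommGroup (ProductSpace t n) :=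
  inferInstanceAs (NormedAddCommGroup
    (WithLp 2 (PiLp 2 (fun j => LorentzSpace (t j)) × PiLp 2 (fun j => SymSpace (n j)))))

instance : InnerProductSpace ℝ (ProductSpace t n) :=
  inferInstanceAs (InnerProductSpace ℝ
    (WithLp 2 (PiLp 2 (fun j => LorentzSpace (t j)) × PiLp 2 (fun j => SymSpace (n j)))))

instance : FiniteDimensional ℝ (ProductSpace t n) :=
  inferInstanceAs (FiniteDimensional ℝ
    (WithLp 2 (PiLp 2 (fun j => LorentzSpace (t j)) × PiLp 2 (fun j => SymSpace (n j)))))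

/-- The element with given blocks. -/
def mk (v : ∀ j, LorentzSpace (t j)) (X : ∀ j, SymSpace (n j)) : ProductSpace t n :=
  WithLp.toLp 2 (WithLp.toLp 2 v, WithLp.toLp 2 X)

/-- The `j`-th vector block. -/
def vec (x : ProductSpace t n) (j : Fin r₁) : LorentzSpace (t j) := WithLp.fst x j

/-- The `j`-th matrix block. -/
def mat (x : ProductSpace t n) (j : Fin r₂) : SymSpace (n j) := WithLp.snd x j

theorem inner_eq (x y : ProductSpace t n) :
    ⟪x, y⟫ = ∑ j, ⟪x.vec j, y.vec j⟫ + ∑ j, ⟪x.mat j, y.mat j⟫ := rfl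

end ProductSpace

/-- The product of the Lorentz cones of sizes `t_j` and the positive semidefinite cones of sizes
`n_j`. -/
def productCone (t : Fin r₁ → ℕ) (n : Fin r₂ → ℕ) : PointedCone ℝ (ProductSpace t n) where
  carrier := {x | (∀ j, x.vec j ∈ lorentzCone (t j)) ∧ ∀ j, x.mat j ∈ psdCone (n j)}
  add_mem' := fun hx hy =>
    ⟨fun j => add_mem (hx.1 j) (hy.1 j), fun j => add_mem (hx.2 j) (hy.2 j)⟩
  zero_mem' := ⟨fun _ => zero_mem _, fun _ => zero_mem _⟩
  smul_mem' := fun a _ hx =>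
    ⟨fun j => Submodule.smul_mem _ a (hx.1 j), fun j => Submodule.smul_mem _ a (hx.2 j)⟩

/-- The element whose `j`-th Lorentz block is the `i`-th unit vector (`i = 1, …, t_j`) and whose
other blocks are zero. -/
def lorentzElt (t : Fin r₁ → ℕ) (n : Fin r₂ → ℕ) (j : Fin r₁) (i : ℕ) : ProductSpace t n :=
  ProductSpace.mk (Pi.single j (lorentzUnit (t j) i)) 0

/-- The element whose `j`-th matrix block has ones at the positions `(i, k)` and `(k, i)`
(`i, k = 1, …, n_j`) and zeros elsewhere, and whose other blocks are zero. -/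
def psdElt (t : Fin r₁ → ℕ) (n : Fin r₂ → ℕ) (j : Fin r₂) (i k : ℕ) : ProductSpace t n :=
  ProductSpace.mk 0 (Pi.single j (symUnit (n j) i k))

/-- The vectors that span `𝓛^⊥`. Blocks are numbered from `0` here, coordinates inside a block
from `1`. -/
inductive IsGenerator (t : Fin r₁ → ℕ) (n : Fin r₂ → ℕ) : ProductSpace t n → Prop
  /-- the first Lorentz block -/
  | lorentz_first (j : Fin r₁) (hj : (j : ℕ) = 0) :
      IsGenerator t n (lorentzElt t n j 1 + lorentzElt t n j 2)
  /-- consecutive Lorentz blocks -/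
  | lorentz_next (j l : Fin r₁) (hjl : (j : ℕ) + 1 = l) :
      IsGenerator t n (lorentzElt t n j 3 + (lorentzElt t n l 1 + lorentzElt t n l 2))
  /-- the first matrix block, when there is no Lorentz block -/
  | psd_first (j : Fin r₂) (hj : (j : ℕ) = 0) (hr : r₁ = 0) :
      IsGenerator t n (psdElt t n j 1 1)
  /-- the last Lorentz block and the first matrix block -/
  | lorentz_psd (j : Fin r₁) (l : Fin r₂) (hj : (j : ℕ) + 1 = r₁) (hl : (l : ℕ) = 0) :
      IsGenerator t n (lorentzElt t n j 3 + psdElt t n l 1 1)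
  /-- consecutive matrix blocks -/
  | psd_next (j l : Fin r₂) (hjl : (j : ℕ) + 1 = l) :
      IsGenerator t n (psdElt t n j (n j) (n j - 1) + psdElt t n l 1 1)
  /-- inside a matrix block -/
  | psd_inner (j : Fin r₂) (i : ℕ) (hi : 1 < i) (hin : i < n j) :
      IsGenerator t n (psdElt t n j i i + psdElt t n j (i - 1) (i + 1))

/-- The subspace `𝓛^⊥`. -/
def worstLPerp (t : Fin r₁ → ℕ) (n : Fin r₂ → ℕ) : Submodule ℝ (ProductSpace t n) :=
  Submodule.span ℝ {v | IsGenerator t n v}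

/-- The subspace `𝓛`, the orthogonal complement of `𝓛^⊥`. -/
def worstL (t : Fin r₁ → ℕ) (n : Fin r₂ → ℕ) : Submodule ℝ (ProductSpace t n) :=
  (worstLPerp t n)ᗮ

/-- The worst-case bound `1 + ∑ dist_poly (K^i)` on the number of facial reduction steps, for the
factors of the product cone. -/
def facialReductionBound (t : Fin r₁ → ℕ) (n : Fin r₂ → ℕ) : ℕ∞ :=
  1 + (∑ j, distPoly (lorentzCone (t j)) + ∑ j, distPoly (psdCone (n j)))

end

/-! Number the generators of `𝓛^⊥ = ker A` along the blocks as `g 0, …, g (N - 1)`. Each splits as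
`g k = lead k + tail (k - 1)`, where `lead k` and `tail k` live in the same block: a boundary
functional such as `x₀ + x₁` or a diagonal entry, and a coordinate or off-diagonal entry. On `K`
every lead is nonnegative, and where `lead k` vanishes so does `tail k`. Hence after cutting by `g
0, …, g (k - 1)` all earlier tails are zero, `g k` acts as `lead k`, and it is a reducing direction.

The order is forced. On the `k`-th face there are points where `g k` equals one and `g (k + 1)` is
an arbitrary real (`exists_inner_leadElt_eq_one`). A combination of generators that is nonnegative
on this face therefore cannot involve any `g i` with `i > k`
(`coeff_eq_zero_of_nonneg_on_cutByFirst`). So every reducing direction acts on this face as a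
nonzero multiple of `g k` and produces the same next face. Since `c = 0` rules out infeasibility
certificates, every run takes exactly `N = r₁ + ∑ (n j - 1)` steps.

For the bound, a proper face of a Lorentz cone is zero or a ray, so its distance to polyhedrality is
1. Strictly nested faces of the semidefinite cone have strictly nested subspaces of vectors `v` with
`v vᵀ` in the face. Nonpolyhedral faces have dimension at least 2 there, which leaves dimensions `2,
…, n` and gives the distance `n - 1`. A cone is shown not to be polyhedral by a parabola on its
boundary whose tangent leaves the cone at once. -/

noncomputable section

/-! ### Facial reduction with a forced order of directions -/

section FacialReductionChain

variable {E : Type*} [NormedAddCommGroup E] [InnerProductSpace ℝ E] {m N : ℕ}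

/-- The points of `K` orthogonal to the first `k` members of the sequence `g`. -/
def cutByFirst (K : PointedCone ℝ E) (g : Fin N → E) (k : ℕ) : PointedCone ℝ E :=
  K ⊓ ((Submodule.span ℝ (g '' {i | (i : ℕ) < k}))ᗮ : Submodule ℝ E)

theorem mem_cutByFirst {K : PointedCone ℝ E} {g : Fin N → E} {k : ℕ} {x : E} :
    x ∈ cutByFirst K g k ↔ x ∈ K ∧ ∀ i : Fin N, (i : ℕ) < k → ⟪g i, x⟫ = 0 := by
  have h : x ∈ (Submodule.span ℝ (g '' {i | (i : ℕ) < k}))ᗮ ↔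
      ∀ i : Fin N, (i : ℕ) < k → ⟪g i, x⟫ = 0 := by
    rw [Submodule.mem_orthogonal]
    constructor
    · intro h i hi
      exact h _ (Submodule.subset_span ⟨i, hi, rfl⟩)
    · intro h u hu
      induction hu using Submodule.span_induction with
      | mem u hu => obtain ⟨i, hi, rfl⟩ := hu; exact h i hi
      | zero => simp
      | add u v _ _ hu hv => rw [inner_add_left, hu, hv, add_zero]
      | smul a u _ hu => rw [inner_smul_left, hu, mul_zero]
  rw [← h]
  rfl

theorem mem_cutByOrthogonal {F : PointedCone ℝ E} {d x : E} :
    x ∈ cutByOrthogonal F d ↔ x ∈ F ∧ ⟪d, x⟫ = 0 := by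
  rw [← Submodule.mem_orthogonal_singleton_iff_inner_right (𝕜 := ℝ)]
  rfl

theorem mem_orthogonal_span_iff {S : Set E} {d : E} :
    d ∈ (Submodule.span ℝ S)ᗮ ↔ ∀ x ∈ S, ⟪d, x⟫ = 0 := by
  rw [Submodule.mem_orthogonal']
  constructor
  · exact fun h x hx => h x (Submodule.subset_span hx)
  · intro h u hu
    induction hu using Submodule.span_induction with
    | mem u hu => exact h u hu
    | zero => simp
    | add u v _ _ hu hv => rw [inner_add_right, hu, hv, add_zero]
    | smul a u _ hu => rw [inner_smul_right, hu, mul_zero]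

/-- If `K` has points orthogonal to `g i` for `i < k` on which `g k` takes the value one and
`g (k + 1)` any prescribed value, then a combination of the `g i` that is nonnegative on
`cutByFirst K g k` involves no `g i` with `k < i`. -/
theorem coeff_eq_zero_of_nonneg_on_cutByFirst {K : PointedCone ℝ E} {g : Fin N → E}
    (htest : ∀ (k : Fin N) (M : ℝ), ∃ x ∈ K, (∀ i < k, ⟪g i, x⟫ = 0) ∧ ⟪g k, x⟫ = 1 ∧
      ∀ l : Fin N, (l : ℕ) = k + 1 → ⟪g l, x⟫ = M)
    {k : ℕ} {c : Fin N → ℝ} (hd : ∀ x ∈ cutByFirst K g k, 0 ≤ ⟪∑ i, c i • g i, x⟫)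
    (i : Fin N) (hi : k < i) : c i = 0 := by
  by_contra hci
  -- Take the last index with a nonzero coefficient and test at its predecessor, where only these
  -- two terms survive.
  obtain ⟨J, hJ, hmax⟩ := (Finset.univ.filter fun i : Fin N => k < i ∧ c i ≠ 0).exists_max_image id
    ⟨i, by simp [hi, hci]⟩
  simp only [Finset.mem_filter, Finset.mem_univ, true_and, id] at hJ hmax
  obtain ⟨hkJ, hcJ⟩ := hJ
  let p : Fin N := ⟨J - 1, by omega⟩
  have hpJ : (J : ℕ) = p + 1 := by simp only [p]; omega
  have hne : p ≠ J := by intro h; rw [h] at hpJ; omega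
  -- The prescribed value makes the combination equal to `c p + c J * M = -1`.
  obtain ⟨x, hxK, hx0, hx1, hxM⟩ := htest p (-(c p + 1) / c J)
  have hx : x ∈ cutByFirst K g k :=
    mem_cutByFirst.2 ⟨hxK, fun i hi => hx0 i (by rw [Fin.lt_def]; omega)⟩
  have h := hd x hx
  rw [sum_inner, Finset.sum_eq_add p J hne] at h
  · rw [inner_smul_left, inner_smul_left, hx1, hxM J hpJ] at h
    simp only [conj_trivial] at h
    rw [mul_div_cancel₀ _ hcJ] at h
    linarith
  · intro i _ hi
    rw [inner_smul_left]
    rcases lt_or_ge i p with hip | hip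
    · rw [hx0 i hip, mul_zero]
    · have hJi : J < i := by
        rw [Fin.lt_def]
        have h1 : (i : ℕ) ≠ p := fun h => hi.1 (Fin.ext h)
        have h2 : (i : ℕ) ≠ J := fun h => hi.2 (Fin.ext h)
        rw [Fin.le_def] at hip
        omega
      have : c i = 0 := by
        by_contra hne
        exact absurd (hmax i ⟨by omega, hne⟩) (not_le.2 hJi)
      simp [this]
  · simp
  · simp

/-- Earlier generators vanish on the face and later ones have zero coefficient, so `d` acts there as
`c k • g k`. Since `d` is not orthogonal to the face, `k < N` and `c k ≠ 0`. The choice of direction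
thus has no influence on the next face. -/
theorem cutByOrthogonal_cutByFirst {K : PointedCone ℝ E} {g : Fin N → E}
    {A : E →ₗ[ℝ] EuclideanSpace ℝ (Fin m)} (hker : LinearMap.ker A = Submodule.span ℝ (Set.range g))
    (htest : ∀ (k : Fin N) (M : ℝ), ∃ x ∈ K, (∀ i < k, ⟪g i, x⟫ = 0) ∧ ⟪g k, x⟫ = 1 ∧
      ∀ l : Fin N, (l : ℕ) = k + 1 → ⟪g l, x⟫ = M)
    {k : ℕ} {d : E} (hd : IsReducingDirection 0 A (cutByFirst K g k) d) :
    k < N ∧ cutByOrthogonal (cutByFirst K g k) d = cutByFirst K g (k + 1) := by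
  obtain ⟨hdual, hAd, hperp, -⟩ := hd
  have hspan : d ∈ Submodule.span ℝ (Set.range g) := hker ▸ hAd
  obtain ⟨c, rfl⟩ := (Submodule.mem_span_range_iff_exists_fun ℝ).1 hspan
  have hc := coeff_eq_zero_of_nonneg_on_cutByFirst htest (k := k) (c := c) fun x hx => by
    have := (PointedCone.mem_dual.1 hdual) hx
    rwa [innerₗ_apply_apply, real_inner_comm] at this
  have hterm : ∀ x ∈ cutByFirst K g k, ∀ i : Fin N, (i : ℕ) ≠ k → ⟪c i • g i, x⟫ = 0 := by
    intro x hx i hi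
    rw [inner_smul_left]
    rcases lt_or_gt_of_ne hi with h | h
    · rw [(mem_cutByFirst.1 hx).2 i h, mul_zero]
    · rw [hc i h]; simp
  have hkN : k < N := by
    by_contra hk
    refine hperp (mem_orthogonal_span_iff.2 fun x hx => ?_)
    rw [sum_inner]
    exact Finset.sum_eq_zero fun i _ => hterm x hx i (by omega)
  have hinner : ∀ x ∈ cutByFirst K g k, ⟪∑ i, c i • g i, x⟫ = c ⟨k, hkN⟩ * ⟪g ⟨k, hkN⟩, x⟫ := by
    intro x hx
    rw [sum_inner, Finset.sum_eq_single_of_mem ⟨k, hkN⟩ (Finset.mem_univ _), inner_smul_left]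
    · simp
    · exact fun i _ hi => hterm x hx i fun h => hi (Fin.ext h)
  have hck : c ⟨k, hkN⟩ ≠ 0 := by
    intro h0
    refine hperp (mem_orthogonal_span_iff.2 fun x hx => ?_)
    rw [hinner x hx, h0, zero_mul]
  refine ⟨hkN, ?_⟩
  ext x
  rw [mem_cutByOrthogonal]
  constructor
  · rintro ⟨hx, h0⟩
    rw [hinner x hx] at h0
    obtain ⟨hxK, hx0⟩ := mem_cutByFirst.1 hx
    refine mem_cutByFirst.2 ⟨hxK, fun i hi => ?_⟩
    rcases Nat.lt_succ_iff_lt_or_eq.1 hi with h | h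
    · exact hx0 i h
    · obtain rfl : i = ⟨k, hkN⟩ := Fin.ext h
      exact (mul_eq_zero.1 h0).resolve_left hck
  · intro hx
    obtain ⟨hxK, hx0⟩ := mem_cutByFirst.1 hx
    have hxk : x ∈ cutByFirst K g k := mem_cutByFirst.2 ⟨hxK, fun i hi => hx0 i (by omega)⟩
    exact ⟨hxk, by rw [hinner x hxk, hx0 ⟨k, hkN⟩ (Nat.lt_succ_self k), mul_zero]⟩

theorem not_isInfeasibilityCertificate_zero {A : E →ₗ[ℝ] EuclideanSpace ℝ (Fin m)}
    {F : PointedCone ℝ E} {d : E} : ¬ IsInfeasibilityCertificate 0 A F d := by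
  rintro ⟨-, -, h⟩
  simp at h

theorem isReducingDirection_cutByFirst {K : PointedCone ℝ E} {g : Fin N → E}
    {A : E →ₗ[ℝ] EuclideanSpace ℝ (Fin m)} (hker : LinearMap.ker A = Submodule.span ℝ (Set.range g))
    (hnonneg : ∀ k : Fin N, ∀ x ∈ K, (∀ i < k, ⟪g i, x⟫ = 0) → 0 ≤ ⟪g k, x⟫)
    (htest : ∀ (k : Fin N) (M : ℝ), ∃ x ∈ K, (∀ i < k, ⟪g i, x⟫ = 0) ∧ ⟪g k, x⟫ = 1 ∧
      ∀ l : Fin N, (l : ℕ) = k + 1 → ⟪g l, x⟫ = M) (k : Fin N) :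
    IsReducingDirection 0 A (cutByFirst K g k) (g k) := by
  refine ⟨?_, ?_, ?_, by simp⟩
  · refine PointedCone.mem_dual.2 fun x hx => ?_
    rw [innerₗ_apply_apply, real_inner_comm]
    obtain ⟨hxK, hx0⟩ := mem_cutByFirst.1 hx
    exact hnonneg k x hxK fun i hi => hx0 i hi
  · have : g k ∈ LinearMap.ker A := hker ▸ Submodule.subset_span ⟨k, rfl⟩
    exact this
  · intro h
    obtain ⟨x, hxK, hx0, hx1, -⟩ := htest k 0
    have := mem_orthogonal_span_iff.1 h x (mem_cutByFirst.2 ⟨hxK, fun i hi => hx0 i hi⟩)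
    rw [hx1] at this
    exact one_ne_zero this

/-- If `ker A` is spanned by a sequence `g` such that the facial reduction of `K` must use its
members one by one, then the singularity degree is the length of the sequence. -/
theorem singularityDegree_eq_of_chain {K : PointedCone ℝ E} {g : Fin N → E}
    {A : E →ₗ[ℝ] EuclideanSpace ℝ (Fin m)} (hker : LinearMap.ker A = Submodule.span ℝ (Set.range g))
    (hnonneg : ∀ k : Fin N, ∀ x ∈ K, (∀ i < k, ⟪g i, x⟫ = 0) → 0 ≤ ⟪g k, x⟫)
    (htest : ∀ (k : Fin N) (M : ℝ), ∃ x ∈ K, (∀ i < k, ⟪g i, x⟫ = 0) ∧ ⟪g k, x⟫ = 1 ∧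
      ∀ l : Fin N, (l : ℕ) = k + 1 → ⟪g l, x⟫ = M) :
    singularityDegree K 0 A = N := by
  have hzero : cutByFirst K g 0 = K := by
    ext x
    simp [mem_cutByFirst]
  have hstep : ∀ (k : ℕ) (hk : k < N), IsReducingDirection 0 A (cutByFirst K g k) (g ⟨k, hk⟩) :=
    fun k hk => isReducingDirection_cutByFirst hker hnonneg htest ⟨k, hk⟩
  -- Backward induction: `j` counts the directions still to be used.
  have hexists : ∀ j ≤ N, ∃ ds : List E, ds.length = j ∧
      IsFacialReductionOutput 0 A (cutByFirst K g (N - j)) ds := by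
    intro j
    induction j with
    | zero =>
      refine fun _ => ⟨[], rfl, .finish _ fun d => ⟨fun hd => ?_, ?_⟩⟩
      · exact absurd (cutByOrthogonal_cutByFirst hker htest hd).1 (by simp)
      · exact not_isInfeasibilityCertificate_zero
    | succ j ih =>
      intro hj
      obtain ⟨ds, hlen, hds⟩ := ih (by omega)
      have hd := hstep (N - (j + 1)) (by omega)
      refine ⟨_ :: ds, by simp [hlen], .step _ _ ds hd ?_⟩
      rw [(cutByOrthogonal_cutByFirst hker htest hd).2]
      rwa [show N - (j + 1) + 1 = N - j by omega]
  -- No run can stop early: while `k < N`, `g k` is still a reducing direction.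
  have hlength : ∀ (F : PointedCone ℝ E) (ds : List E), IsFacialReductionOutput 0 A F ds →
      ∀ k ≤ N, F = cutByFirst K g k → N ≤ ds.length + k := by
    intro F ds h
    induction h with
    | finish F h =>
      rintro k hk rfl
      rcases hk.lt_or_eq with hk | rfl
      · exact absurd (hstep k hk) (h _).1
      · simp
    | infeasible F d h => exact absurd h not_isInfeasibilityCertificate_zero
    | step F d ds h _ ih =>
      rintro k hk rfl
      obtain ⟨hkN, hcut⟩ := cutByOrthogonal_cutByFirst hker htest h
      have := ih (k + 1) hkN hcut
      simp only [List.length_cons]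
      omega
  obtain ⟨ds, hlen, hds⟩ := hexists N le_rfl
  rw [Nat.sub_self, hzero] at hds
  refine le_antisymm ((iInf₂_le ds hds).trans_eq (by rw [hlen])) (le_iInf₂ fun ds hds => ?_)
  have := hlength K ds hds 0 (Nat.zero_le _) hzero.symm
  exact_mod_cast this

end FacialReductionChain

/-! ### Criteria for polyhedral and nonpolyhedral cones -/

section Polyhedral

variable {E : Type*} [NormedAddCommGroup E] [InnerProductSpace ℝ E]

/-- A cone all of whose points are nonnegative multiples of one of its points is polyhedral. -/
theorem isPolyhedralCone_of_ray [FiniteDimensional ℝ E] {F : PointedCone ℝ E} {x : E} (hx : x ∈ F)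
    (h : ∀ y ∈ F, ∃ a : ℝ, 0 ≤ a ∧ y = a • x) : IsPolyhedralCone F := by
  obtain ⟨S, hS⟩ := IsNoetherian.noetherian ((ℝ ∙ x)ᗮ)
  -- Generators of `x^⊥`, taken with both signs, cut out the line through `x`; `x` itself selects
  -- the half-line.
  have hdual : PointedCone.dual (innerₗ E) ({x} ∪ ((S : Set E) ∪ Neg.neg '' (S : Set E))) = F := by
    ext y
    simp only [PointedCone.mem_dual, innerₗ_apply_apply]
    constructor
    · intro hy
      have hperp : y ∈ ((ℝ ∙ x)ᗮ)ᗮ := by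
        rw [← hS, mem_orthogonal_span_iff]
        intro b hb
        have h1 := hy (Or.inr (Or.inl hb))
        have h2 := hy (Or.inr (Or.inr ⟨b, hb, rfl⟩))
        rw [inner_neg_left] at h2
        rw [real_inner_comm]
        linarith
      rw [Submodule.orthogonal_orthogonal, Submodule.mem_span_singleton] at hperp
      obtain ⟨a, rfl⟩ := hperp
      have h1 := hy (Or.inl rfl)
      rw [inner_smul_right, real_inner_self_eq_norm_sq] at h1
      rcases eq_or_ne x 0 with rfl | hx0
      · simp
      · have ha : 0 ≤ a := nonneg_of_mul_nonneg_left h1 (by positivity)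
        exact F.smul_mem ha hx
    · intro hy b hb
      obtain ⟨a, ha, rfl⟩ := h y hy
      rw [inner_smul_right]
      have hS0 : ∀ b ∈ (S : Set E), ⟪b, x⟫ = 0 := by
        intro b hb
        have : b ∈ (ℝ ∙ x)ᗮ := hS ▸ Submodule.subset_span hb
        exact Submodule.mem_orthogonal_singleton_iff_inner_left.1 this
      rcases hb with rfl | hb | ⟨b, hb, rfl⟩
      · exact mul_nonneg ha real_inner_self_nonneg
      · rw [hS0 b hb, mul_zero]
      · rw [inner_neg_left, hS0 b hb, neg_zero, mul_zero]
  rw [← hdual]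
  exact PointedCone.DualFG.dual_of_finite _
    ((Set.finite_singleton x).union (S.finite_toSet.union (S.finite_toSet.image _)))

/-- A polyhedral cone containing the parabola `x + s u + s² w` contains an initial segment of its
tangent at `x`. -/
theorem IsPolyhedralCone.exists_tangent_mem {F : PointedCone ℝ E} (hF : IsPolyhedralCone F)
    {x u w : E} (h : ∀ s : ℝ, x + s • u + s ^ 2 • w ∈ F) : ∃ s : ℝ, 0 < s ∧ x + s • u ∈ F := by
  obtain ⟨S, rfl⟩ := hF
  have hpos : ∀ a ∈ S, ∀ s : ℝ, 0 ≤ ⟪a, x⟫ + s * ⟪a, u⟫ + s ^ 2 * ⟪a, w⟫ := by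
    intro a ha s
    have := PointedCone.mem_dual.1 (h s) (Finset.mem_coe.2 ha)
    rwa [innerₗ_apply_apply, inner_add_right, inner_add_right, inner_smul_right,
      inner_smul_right] at this
  have hev : ∀ a ∈ S, ∀ᶠ s : ℝ in nhdsWithin 0 (Set.Ioi 0), 0 ≤ ⟪a, x + s • u⟫ := by
    intro a ha
    have hx : 0 ≤ ⟪a, x⟫ := by simpa using hpos a ha 0
    rcases hx.lt_or_eq with hx | hx
    · have hc : Continuous fun s : ℝ => ⟪a, x + s • u⟫ := by fun_prop
      have := hc.continuousAt.eventually (lt_mem_nhds (a := 0) (b := ⟪a, x + (0 : ℝ) • u⟫)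
        (by simpa using hx))
      exact Filter.Eventually.mono (nhdsWithin_le_nhds this) fun s hs => hs.le
    -- If `a` is active at `x`, a nonzero linear term would dominate the quadratic one for small `s`
    -- of a suitable sign.
    · have hu : ⟪a, u⟫ = 0 := by
        by_contra hu
        have hw : 0 ≤ ⟪a, w⟫ := by
          have h1 := hpos a ha 1
          have h2 := hpos a ha (-1)
          linarith
        -- This parameter makes the value minus a nonzero square; the `+ 1` keeps the denominator
        -- positive.
        have h1 := hpos a ha (-⟪a, u⟫ / (⟪a, w⟫ + 1))
        rw [← hx, zero_add] at h1
        have h2 : -⟪a, u⟫ / (⟪a, w⟫ + 1) * ⟪a, u⟫ + (-⟪a, u⟫ / (⟪a, w⟫ + 1)) ^ 2 * ⟪a, w⟫ =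
            -(⟪a, u⟫ / (⟪a, w⟫ + 1)) ^ 2 := by
          field_simp
          ring
        rw [h2] at h1
        have : 0 < (⟪a, u⟫ / (⟪a, w⟫ + 1)) ^ 2 := by positivity
        linarith
      refine Filter.Eventually.of_forall fun s => ?_
      rw [inner_add_right, inner_smul_right, hu, ← hx]
      simp
  have hall : ∀ᶠ s : ℝ in nhdsWithin 0 (Set.Ioi 0), ∀ a ∈ S, 0 ≤ ⟪a, x + s • u⟫ :=
    (Filter.eventually_all_finset S).2 hev
  obtain ⟨s, hs, hs0⟩ := (hall.and self_mem_nhdsWithin).exists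
  exact ⟨s, hs0, PointedCone.mem_dual.2 fun a ha => hs _ ha⟩

end Polyhedral

/-! ### The Lorentz cone and its distance to polyhedrality -/

section Lorentz

theorem mem_lorentzCone {t : ℕ} {x : LorentzSpace t} : x ∈ lorentzCone t ↔ ‖x.snd‖ ≤ x.fst := Iff.rfl

theorem inner_lorentzUnit_one {t : ℕ} (x : LorentzSpace t) : ⟪lorentzUnit t 1, x⟫ = x.fst := by
  rw [WithLp.prod_inner_apply, PiLp.inner_apply]
  simp [lorentzUnit]

theorem inner_lorentzUnit_add_two {t k : ℕ} (hk : k < t - 1) (x : LorentzSpace t) :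
    ⟪lorentzUnit t (k + 2), x⟫ = x.snd ⟨k, hk⟩ := by
  rw [WithLp.prod_inner_apply, PiLp.inner_apply, Finset.sum_eq_single_of_mem ⟨k, hk⟩ (by simp)]
  · simp [lorentzUnit]
  · intro b _ hb
    have : (b : ℕ) ≠ k := fun h => hb (Fin.ext h)
    simp [lorentzUnit, this]

/-- The point with coordinates `a, b, c, 0, …, 0`. -/
def lorentzPoint (t : ℕ) (a b c : ℝ) : LorentzSpace t :=
  a • lorentzUnit t 1 + b • lorentzUnit t 2 + c • lorentzUnit t 3

theorem lorentzPoint_fst (t : ℕ) (a b c : ℝ) : (lorentzPoint t a b c).fst = a := by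
  simp [lorentzPoint, lorentzUnit]

theorem lorentzPoint_snd (t : ℕ) (a b c : ℝ) (k : Fin (t - 1)) :
    (lorentzPoint t a b c).snd k = if (k : ℕ) = 0 then b else if (k : ℕ) = 1 then c else 0 := by
  rcases k with ⟨_ | _ | k, hk⟩ <;> simp [lorentzPoint, lorentzUnit]

theorem lorentzPoint_mem_iff {t : ℕ} (ht : 3 ≤ t) {a b c : ℝ} :
    lorentzPoint t a b c ∈ lorentzCone t ↔ 0 ≤ a ∧ b ^ 2 + c ^ 2 ≤ a ^ 2 := by
  have hnorm : ‖(lorentzPoint t a b c).snd‖ ^ 2 = b ^ 2 + c ^ 2 := by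
    rw [EuclideanSpace.norm_sq_eq, Finset.sum_eq_add (⟨0, by omega⟩ : Fin (t - 1)) ⟨1, by omega⟩]
    · simp [lorentzPoint_snd]
    · simp
    · intro k _ hk
      have h0 : (k : ℕ) ≠ 0 := fun h => hk.1 (Fin.ext h)
      have h1 : (k : ℕ) ≠ 1 := fun h => hk.2 (Fin.ext h)
      simp [lorentzPoint_snd, h0, h1]
    · simp
    · simp
  rw [mem_lorentzCone, lorentzPoint_fst, ← hnorm]
  constructor
  · intro h
    have := (norm_nonneg _).trans h
    exact ⟨this, by gcongr⟩
  · rintro ⟨ha, h⟩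
    exact (sq_le_sq₀ (norm_nonneg _) ha).1 h

/-- The parabola `(1 + s², 1 - s², 2s)` lies on the boundary, while its tangent points `(1, 1, 2s)`
with `s > 0` lie outside. -/
theorem not_isPolyhedralCone_lorentzCone {t : ℕ} (ht : 3 ≤ t) :
    ¬ IsPolyhedralCone (lorentzCone t) := by
  intro h
  have hcomb : ∀ s r : ℝ, lorentzPoint t 1 1 0 + s • lorentzPoint t 0 0 2 +
      r • lorentzPoint t 1 (-1) 0 = lorentzPoint t (1 + r) (1 - r) (2 * s) := by
    intro s r
    simp only [lorentzPoint]
    module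
  obtain ⟨s, hs, hmem⟩ := h.exists_tangent_mem (x := lorentzPoint t 1 1 0)
    (u := lorentzPoint t 0 0 2) (w := lorentzPoint t 1 (-1) 0) fun s => by
      rw [hcomb, lorentzPoint_mem_iff ht]
      exact ⟨by positivity, le_of_eq (by ring)⟩
  have h0 := hcomb s 0
  rw [zero_smul, add_zero] at h0
  rw [h0, lorentzPoint_mem_iff ht] at hmem
  nlinarith [hmem.2]

/-- The proper faces of the Lorentz cone are polyhedral. -/
theorem eq_lorentzCone_of_not_isPolyhedralCone {t : ℕ} {F : PointedCone ℝ (LorentzSpace t)}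
    (hF : F.IsFaceOf (lorentzCone t)) (hpoly : ¬ IsPolyhedralCone F) : F = lorentzCone t := by
  by_contra hne
  -- A face with an interior point of the cone is the whole cone: subtract from that point a small
  -- multiple of any `y`.
  have hbd : ∀ x ∈ F, ‖x.snd‖ = x.fst := by
    intro x hx
    by_contra hxne
    have hlt : ‖x.snd‖ < x.fst := lt_of_le_of_ne (hF.le hx) hxne
    refine hne (le_antisymm hF.le fun y hy => ?_)
    have hy0 : ‖y.snd‖ ≤ y.fst := hy
    have hy1 : 0 ≤ y.fst := (norm_nonneg _).trans hy0
    -- Subtracting `a • y` costs at most `2 * a * y.fst` of the slack of `x`; the `+ 1` covers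
    -- `y.fst = 0`.
    set a := (x.fst - ‖x.snd‖) / (2 * y.fst + 1) with ha
    have hapos : 0 < a := div_pos (by linarith) (by linarith)
    have hale : a * (2 * y.fst) ≤ x.fst - ‖x.snd‖ := by
      have : a * (2 * y.fst + 1) = x.fst - ‖x.snd‖ := div_mul_cancel₀ _ (by positivity)
      linarith
    have hsub : x - a • y ∈ lorentzCone t := by
      rw [mem_lorentzCone]
      simp only [WithLp.sub_fst, WithLp.sub_snd, WithLp.smul_fst, WithLp.smul_snd, smul_eq_mul]
      have h1 := norm_sub_le x.snd (a • y.snd)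
      rw [norm_smul, Real.norm_of_nonneg hapos.le] at h1
      have h2 : a * ‖y.snd‖ ≤ a * y.fst := by gcongr
      linarith
    exact hF.mem_of_smul_add_mem hy hsub hapos (by rwa [add_sub_cancel])
  refine hpoly ?_
  by_cases hzero : ∀ y ∈ F, y = 0
  · exact isPolyhedralCone_of_ray F.zero_mem fun y hy => ⟨0, le_rfl, by rw [hzero y hy, smul_zero]⟩
  · push Not at hzero
    obtain ⟨x, hx, hx0⟩ := hzero
    have hxpos : 0 < x.fst := by
      rw [← hbd x hx]
      refine (norm_nonneg _).lt_of_ne' fun h => hx0 ?_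
      have h1 := hbd x hx
      rw [h] at h1
      exact WithLp.ofLp_injective 2 (Prod.ext h1.symm (norm_eq_zero.1 h))
    refine isPolyhedralCone_of_ray hx fun y hy => ⟨y.fst / x.fst, ?_, ?_⟩
    · exact div_nonneg ((norm_nonneg _).trans (hF.le hy)) hxpos.le
    -- The sum `x + y` is again a boundary point, so the triangle inequality is an equality.
    · have hray : SameRay ℝ x.snd y.snd := by
        rw [sameRay_iff_norm_add, hbd x hx, hbd y hy, ← WithLp.add_snd, hbd _ (F.add_mem hx hy),
          WithLp.add_fst]
      rw [sameRay_iff_norm_smul_eq, hbd x hx, hbd y hy] at hray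
      refine WithLp.ofLp_injective 2 (Prod.ext ?_ ?_)
      · exact (div_mul_cancel₀ _ hxpos.ne').symm
      · change y.snd = (y.fst / x.fst) • x.snd
        rw [div_eq_inv_mul, mul_smul, ← hray, smul_smul, inv_mul_cancel₀ hxpos.ne', one_smul]

theorem bot_isFaceOf_lorentzCone (t : ℕ) :
    (⊥ : PointedCone ℝ (LorentzSpace t)).IsFaceOf (lorentzCone t) := by
  refine ⟨bot_le, fun {x y a} hx hy ha h => ?_⟩
  rw [Submodule.mem_bot] at h ⊢
  have h1 : a * x.fst + y.fst = 0 := congrArg WithLp.fst h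
  have hy0 : 0 ≤ y.fst := (norm_nonneg _).trans hy
  have hx0 : 0 ≤ x.fst := (norm_nonneg _).trans hx
  have hx1 : x.fst = 0 := by
    by_contra hne
    have : 0 < a * x.fst := by positivity
    linarith
  have hx2 : ‖x.snd‖ ≤ 0 := hx1 ▸ hx
  exact WithLp.ofLp_injective 2 (Prod.ext hx1 (norm_le_zero_iff.1 hx2))

theorem distPoly_lorentzCone {t : ℕ} (ht : 3 ≤ t) : distPoly (lorentzCone t) = 1 := by
  have hpoly := not_isPolyhedralCone_lorentzCone ht
  refine le_antisymm (iSup₂_le ?_) ?_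
  · rintro F ⟨hface, -, hnot⟩
    by_contra hlen
    have hlen : 1 < F.length := by
      rw [not_le] at hlen
      exact_mod_cast hlen
    have h1 := eq_lorentzCone_of_not_isPolyhedralCone (hface ⟨1, by omega⟩)
      (hnot ⟨1, by omega⟩ (by simp [Fin.ext_iff]))
    have h2 : F ⟨1, by omega⟩ < F ⟨2, by omega⟩ := F.strictMono (by simp [Fin.lt_def])
    rw [h1] at h2
    exact absurd (hface ⟨2, by omega⟩).le (not_le_of_gt h2)
  · have hbot : IsPolyhedralCone (⊥ : PointedCone ℝ (LorentzSpace t)) :=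
      isPolyhedralCone_of_ray (zero_mem _) fun y hy => ⟨0, le_rfl, by simpa using hy⟩
    have hlt : (⊥ : PointedCone ℝ (LorentzSpace t)) < lorentzCone t :=
      bot_lt_iff_ne_bot.2 fun h => hpoly (h ▸ hbot)
    let F : LTSeries (PointedCone ℝ (LorentzSpace t)) :=
      LTSeries.mk 1 ![⊥, lorentzCone t] (by
        rw [Fin.strictMono_iff_lt_succ]
        intro i
        fin_cases i
        exact hlt)
    refine le_iSup₂_of_le F ⟨fun i => ?_, hbot, fun i hi => ?_⟩ (by simp [F])
    · change Fin 2 at i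
      fin_cases i
      · exact bot_isFaceOf_lorentzCone t
      · exact .refl _
    · change Fin 2 at i
      fin_cases i
      · exact absurd rfl hi
      · exact hpoly

end Lorentz

/-! ### The semidefinite cone, its faces and its distance to polyhedrality -/

section PositiveSemidefinite

variable {n : ℕ}

theorem SymSpace.ext_entry {X Y : SymSpace n} (h : ∀ p q, X.toMatrix p q = Y.toMatrix p q) :
    X = Y := by
  refine Subtype.ext (PiLp.ext ?_)
  rintro ⟨p, q⟩
  exact h p q

theorem SymSpace.toMatrix_add (X Y : SymSpace n) (p q : Fin n) :
    (X + Y).toMatrix p q = X.toMatrix p q + Y.toMatrix p q := rfl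

theorem SymSpace.toMatrix_smul (a : ℝ) (X : SymSpace n) (p q : Fin n) :
    (a • X).toMatrix p q = a * X.toMatrix p q := rfl

theorem SymSpace.toMatrix_sum {ι : Type*} (s : Finset ι) (X : ι → SymSpace n) (p q : Fin n) :
    (∑ i ∈ s, X i).toMatrix p q = ∑ i ∈ s, (X i).toMatrix p q := by
  classical
  induction s using Finset.induction_on with
  | empty => rfl
  | insert i s hi ih => rw [Finset.sum_insert hi, Finset.sum_insert hi, toMatrix_add, ih]

theorem mem_psdCone {X : SymSpace n} : X ∈ psdCone n ↔ X.toMatrix.PosSemidef := Iff.rfl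

/-- The symmetric matrix `v vᵀ`. -/
def symOuter (v : Fin n → ℝ) : SymSpace n :=
  ⟨WithLp.toLp 2 fun pq => v pq.1 * v pq.2, fun _ _ => mul_comm _ _⟩

theorem symOuter_toMatrix (v : Fin n → ℝ) (p q : Fin n) :
    (symOuter v).toMatrix p q = v p * v q := rfl

theorem symOuter_mem_psdCone (v : Fin n → ℝ) : symOuter v ∈ psdCone n :=
  Matrix.posSemidef_vecMulVec_self_star v

theorem symOuter_smul (a : ℝ) (v : Fin n → ℝ) : symOuter (a • v) = a ^ 2 • symOuter v :=
  SymSpace.ext_entry fun p q => by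
    simp only [symOuter_toMatrix, SymSpace.toMatrix_smul, Pi.smul_apply, smul_eq_mul]
    ring

theorem exists_eq_sum_symOuter {X : SymSpace n} (hX : X ∈ psdCone n) :
    ∃ (k : ℕ) (v : Fin k → Fin n → ℝ), X = ∑ i, symOuter (v i) := by
  obtain ⟨k, v, hv⟩ := Matrix.posSemidef_iff_eq_sum_vecMulVec.1 (mem_psdCone.1 hX)
  refine ⟨k, v, SymSpace.ext_entry fun p q => ?_⟩
  rw [hv, SymSpace.toMatrix_sum, Matrix.sum_apply]
  rfl

theorem diag_nonneg_of_mem_psdCone {X : SymSpace n} (hX : X ∈ psdCone n) (p : Fin n) :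
    0 ≤ X.toMatrix p p := (mem_psdCone.1 hX).diag_nonneg

theorem entry_eq_zero_of_mem_psdCone {X : SymSpace n} (hX : X ∈ psdCone n) {p : Fin n}
    (hp : X.toMatrix p p = 0) (q : Fin n) : X.toMatrix p q = 0 := by
  obtain ⟨k, v, rfl⟩ := exists_eq_sum_symOuter hX
  simp only [SymSpace.toMatrix_sum, symOuter_toMatrix] at hp ⊢
  rw [Finset.sum_eq_zero_iff_of_nonneg fun i _ => mul_self_nonneg _] at hp
  exact Finset.sum_eq_zero fun i hi => by rw [mul_self_eq_zero.1 (hp i hi), zero_mul]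

/-- The vectors `v` such that the face `F` contains `v vᵀ`. -/
def faceSpace {F : PointedCone ℝ (SymSpace n)} (hF : F.IsFaceOf (psdCone n)) :
    Submodule ℝ (Fin n → ℝ) where
  carrier := {v | symOuter v ∈ F}
  add_mem' := by
    intro v w hv hw
    -- The parallelogram identity: the right side is in the face, hence so is each summand on the
    -- left.
    have h : symOuter (v + w) + symOuter (v - w) =
        (symOuter v + symOuter v) + (symOuter w + symOuter w) :=
      SymSpace.ext_entry fun p q => by
        simp only [symOuter_toMatrix, SymSpace.toMatrix_add, Pi.add_apply, Pi.sub_apply]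
        ring
    exact hF.mem_of_add_mem_left (symOuter_mem_psdCone _) (symOuter_mem_psdCone _)
      (h ▸ F.add_mem (F.add_mem hv hv) (F.add_mem hw hw))
  zero_mem' := by
    have h : symOuter (0 : Fin n → ℝ) = 0 := SymSpace.ext_entry fun p q => zero_mul _
    change symOuter (0 : Fin n → ℝ) ∈ F
    rw [h]
    exact F.zero_mem
  smul_mem' := by
    intro a v hv
    change symOuter (a • v) ∈ F
    rw [symOuter_smul]
    exact F.smul_mem (sq_nonneg a) hv

theorem sum_symOuter_mem_iff {F : PointedCone ℝ (SymSpace n)} (hF : F.IsFaceOf (psdCone n)) {k : ℕ}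
    (v : Fin k → Fin n → ℝ) : ∑ i, symOuter (v i) ∈ F ↔ ∀ i, v i ∈ faceSpace hF :=
  hF.sum_mem_iff_mem fun _ => symOuter_mem_psdCone _

/-- A face is determined by its vectors, because every positive semidefinite matrix is a sum of `v
vᵀ` and a face contains such a sum exactly when it contains each term. -/
theorem faceSpace_lt {F G : PointedCone ℝ (SymSpace n)} (hF : F.IsFaceOf (psdCone n))
    (hG : G.IsFaceOf (psdCone n)) (h : F < G) : faceSpace hF < faceSpace hG := by
  refine lt_of_le_not_ge (fun v hv => h.le hv) fun hle => not_le_of_gt h fun X hX => ?_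
  obtain ⟨k, v, rfl⟩ := exists_eq_sum_symOuter (hG.le hX)
  rw [sum_symOuter_mem_iff hG] at hX
  exact (sum_symOuter_mem_iff hF v).2 fun i => hle (hX i)

theorem isPolyhedralCone_of_finrank_faceSpace_le_one {F : PointedCone ℝ (SymSpace n)}
    (hF : F.IsFaceOf (psdCone n)) (h : Module.finrank ℝ (faceSpace hF) ≤ 1) :
    IsPolyhedralCone F := by
  obtain ⟨⟨v, hv⟩, hspan⟩ := finrank_le_one_iff.1 h
  refine isPolyhedralCone_of_ray hv fun X hX => ?_
  obtain ⟨k, w, rfl⟩ := exists_eq_sum_symOuter (hF.le hX)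
  rw [sum_symOuter_mem_iff hF] at hX
  choose a ha using fun i => hspan ⟨w i, hX i⟩
  refine ⟨∑ i, a i ^ 2, by positivity, ?_⟩
  rw [Finset.sum_smul]
  refine Finset.sum_congr rfl fun i _ => ?_
  rw [← symOuter_smul]
  exact congrArg symOuter (congrArg Subtype.val (ha i)).symm

/-- The face of the matrices supported on the first `k + 1` coordinates. -/
def leadingFace (n k : ℕ) : PointedCone ℝ (SymSpace n) where
  carrier := {X | X ∈ psdCone n ∧ ∀ p : Fin n, k < p → X.toMatrix p p = 0}
  add_mem' := fun hX hY => ⟨add_mem hX.1 hY.1, fun p hp => by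
    rw [SymSpace.toMatrix_add, hX.2 p hp, hY.2 p hp, add_zero]⟩
  zero_mem' := ⟨zero_mem _, fun _ _ => rfl⟩
  smul_mem' := fun a _ hX => ⟨Submodule.smul_mem _ a hX.1, fun p hp => by
    change (a : ℝ) * _ = 0
    have := hX.2 p hp
    exact mul_eq_zero_of_right _ this⟩

theorem mem_leadingFace {k : ℕ} {X : SymSpace n} : X ∈ leadingFace n k ↔
    X ∈ psdCone n ∧ ∀ p : Fin n, k < p → X.toMatrix p p = 0 := Iff.rfl

theorem leadingFace_isFaceOf (n k : ℕ) : (leadingFace n k).IsFaceOf (psdCone n) := by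
  refine ⟨fun X hX => hX.1, fun {X Y a} hX hY ha h => ⟨hX, fun p hp => ?_⟩⟩
  have h1 := h.2 p hp
  rw [SymSpace.toMatrix_add, SymSpace.toMatrix_smul] at h1
  have hX0 := diag_nonneg_of_mem_psdCone hX p
  have hY0 := diag_nonneg_of_mem_psdCone hY p
  by_contra hne
  have : 0 < a * X.toMatrix p p := by positivity
  linarith

theorem symOuter_mem_leadingFace {k : ℕ} {v : Fin n → ℝ} :
    symOuter v ∈ leadingFace n k ↔ ∀ p : Fin n, k < p → v p = 0 := by
  simp [mem_leadingFace, symOuter_mem_psdCone, symOuter_toMatrix]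

theorem leadingFace_lt {k l : ℕ} (hkl : k < l) (hl : l < n) :
    leadingFace n k < leadingFace n l := by
  refine lt_of_le_not_ge (fun X hX => ⟨hX.1, fun p hp => hX.2 p (by omega)⟩) fun hle => ?_
  have h : symOuter (Pi.single ⟨l, hl⟩ 1) ∈ leadingFace n l :=
    symOuter_mem_leadingFace.2 fun p hp =>
      Pi.single_eq_of_ne (fun h => by rw [h] at hp; exact lt_irrefl _ hp) _
  have := symOuter_mem_leadingFace.1 (hle h) ⟨l, hl⟩ hkl
  simp at this

theorem isPolyhedralCone_leadingFace_zero (hn : 0 < n) : IsPolyhedralCone (leadingFace n 0) := by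
  refine isPolyhedralCone_of_finrank_faceSpace_le_one (leadingFace_isFaceOf n 0) ?_
  have he : Pi.single ⟨0, hn⟩ 1 ∈ faceSpace (leadingFace_isFaceOf n 0) :=
    symOuter_mem_leadingFace.2 fun p hp =>
      Pi.single_eq_of_ne (fun h => by rw [h] at hp; exact lt_irrefl _ hp) _
  refine finrank_le_one ⟨_, he⟩ fun w => ⟨w.1 ⟨0, hn⟩, Subtype.ext (funext fun p => ?_)⟩
  by_cases hp : p = ⟨0, hn⟩
  · subst hp
    simp
  · have hp0 : 0 < (p : ℕ) := Nat.pos_of_ne_zero fun h => hp (Fin.ext h)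
    have := symOuter_mem_leadingFace.1 w.2 p hp0
    simp [this, hp]

/-- The parabola `(e₁ + s e₂)(e₁ + s e₂)ᵀ` lies in the face. Its tangent at `e₁ e₁ᵀ` has a zero
diagonal entry in a row with the nonzero entry `s`. -/
theorem not_isPolyhedralCone_leadingFace {k : ℕ} (hk : 0 < k) (hn : 1 < n) :
    ¬ IsPolyhedralCone (leadingFace n k) := by
  intro h
  let p : Fin n := ⟨0, by omega⟩
  let q : Fin n := ⟨1, hn⟩
  have hpq : p ≠ q := by simp [p, q]
  let v : Fin n → ℝ := Pi.single p 1
  let w : Fin n → ℝ := Pi.single q 1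
  let u : SymSpace n := symOuter (v + w) - symOuter v - symOuter w
  have hu : ∀ i j, u.toMatrix i j = v i * w j + w i * v j := by
    intro i j
    change (v i + w i) * (v j + w j) - v i * v j - w i * w j = _
    ring
  have hvp : v p = 1 := Pi.single_eq_same _ _
  have hvq : v q = 0 := Pi.single_eq_of_ne hpq.symm _
  have hwp : w p = 0 := Pi.single_eq_of_ne hpq _
  have hwq : w q = 1 := Pi.single_eq_same _ _
  obtain ⟨s, hs, hmem⟩ := h.exists_tangent_mem (x := symOuter v) (u := u) (w := symOuter w)
    fun s => by
      have hsum : symOuter v + s • u + s ^ 2 • symOuter w = symOuter (v + s • w) :=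
        SymSpace.ext_entry fun i j => by
          simp only [SymSpace.toMatrix_add, SymSpace.toMatrix_smul, hu, symOuter_toMatrix,
            Pi.add_apply, Pi.smul_apply, smul_eq_mul]
          ring
      rw [hsum, symOuter_mem_leadingFace]
      intro i hi
      have hip : i ≠ p := by rintro rfl; simp [p] at hi
      have hiq : i ≠ q := by rintro rfl; simp [q] at hi; omega
      simp [v, w, hip, hiq]
  have hentry : ∀ i j, (symOuter v + s • u).toMatrix i j =
      v i * v j + s * (v i * w j + w i * v j) := fun i j => by
    rw [SymSpace.toMatrix_add, SymSpace.toMatrix_smul, hu, symOuter_toMatrix]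
  have h0 := entry_eq_zero_of_mem_psdCone hmem.1 (p := q) (by rw [hentry, hvq]; ring) p
  rw [hentry, hvp, hvq, hwp, hwq] at h0
  linarith

theorem distPoly_psdCone (hn : 2 ≤ n) : distPoly (psdCone n) = ((n - 1 : ℕ) : ℕ∞) := by
  refine le_antisymm (iSup₂_le ?_) ?_
  · rintro F ⟨hface, -, hnot⟩
    -- The first nonpolyhedral face already has dimension at least 2, and each strict inclusion adds
    -- at least one.
    have hdim : ∀ k : ℕ, ∀ hk : k + 1 < F.length + 1,
        k + 2 ≤ Module.finrank ℝ (faceSpace (hface ⟨k + 1, hk⟩)) := by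
      intro k
      induction k with
      | zero =>
        intro hk
        by_contra hlt
        exact hnot ⟨0 + 1, hk⟩ (by simp [Fin.ext_iff])
          (isPolyhedralCone_of_finrank_faceSpace_le_one (hface ⟨0 + 1, hk⟩) (by omega))
      | succ k ih =>
        intro hk
        have h1 := ih (by omega)
        have h2 := Submodule.finrank_lt_finrank_of_lt (faceSpace_lt (hface ⟨k + 1, by omega⟩)
          (hface ⟨k + 1 + 1, hk⟩) (F.strictMono (by simp [Fin.lt_def])))
        omega
    have hlen : F.length ≤ n - 1 := by
      rcases Nat.eq_zero_or_pos F.length with h0 | h0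
      · omega
      · have h1 := hdim (F.length - 1) (by omega)
        have h2 := Submodule.finrank_le (faceSpace (hface ⟨F.length - 1 + 1, by omega⟩))
        rw [Module.finrank_fin_fun] at h2
        omega
    exact_mod_cast hlen
  · let F : LTSeries (PointedCone ℝ (SymSpace n)) :=
      LTSeries.mk (n - 1) (fun i => leadingFace n i)
        fun i j hij => leadingFace_lt hij (by have := j.2; omega)
    refine le_iSup₂_of_le F ⟨fun i => leadingFace_isFaceOf n i,
      isPolyhedralCone_leadingFace_zero (by omega), fun i hi => ?_⟩ le_rfl
    exact not_isPolyhedralCone_leadingFace (Nat.pos_of_ne_zero fun h => hi (Fin.ext h)) (by omega)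

end PositiveSemidefinite

/-! ### Generators linking a lead to the preceding tail -/

section LinkedSequence

variable {E : Type*} [NormedAddCommGroup E] {N : ℕ}

/-- The sequence `lead 0, lead 1 + tail 0, lead 2 + tail 1, …`. -/
def linkedSequence (lead tail : Fin N → E) (k : Fin N) : E :=
  lead k + if 0 < (k : ℕ) then tail ⟨k - 1, by omega⟩ else 0

theorem linkedSequence_of_eq_zero {lead tail : Fin N → E} {k : Fin N} (hk : (k : ℕ) = 0) :
    linkedSequence lead tail k = lead k := by
  simp [linkedSequence, hk]

theorem linkedSequence_of_eq_add_one {lead tail : Fin N → E} {k l : Fin N}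
    (hkl : (l : ℕ) = k + 1) : linkedSequence lead tail l = lead l + tail k := by
  rw [linkedSequence, if_pos (by omega)]
  congr 2
  exact Fin.ext (by simp [hkl])

variable [InnerProductSpace ℝ E]

theorem inner_linkedSequence {lead tail : Fin N → E} {x : E} {k : Fin N}
    (h : ∀ i < k, ⟪tail i, x⟫ = 0) : ⟪linkedSequence lead tail k, x⟫ = ⟪lead k, x⟫ := by
  rw [linkedSequence, inner_add_left]
  split_ifs with hk
  · rw [h _ (by rw [Fin.lt_def]; simp only; omega), add_zero]
  · simp

/-- Vanishing propagates along the chain: zero leads kill their tails, which turns the next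
generator into its lead. -/
theorem inner_lead_eq_zero {K : PointedCone ℝ E} {lead tail : Fin N → E}
    (hzero : ∀ x ∈ K, ∀ k, ⟪lead k, x⟫ = 0 → ⟪tail k, x⟫ = 0) {x : E} (hx : x ∈ K) {k : Fin N}
    (h : ∀ i < k, ⟪linkedSequence lead tail i, x⟫ = 0) : ∀ i < k, ⟪lead i, x⟫ = 0 := by
  intro i
  induction i using WellFoundedLT.induction with
  | ind i ih =>
    intro hi
    rw [← inner_linkedSequence (tail := tail) fun l hl => hzero x hx l (ih l hl (hl.trans hi))]
    exact h i hi

theorem singularityDegree_eq_of_linkedSequence {m : ℕ} {K : PointedCone ℝ E}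
    {lead tail : Fin N → E} {A : E →ₗ[ℝ] EuclideanSpace ℝ (Fin m)}
    (hker : LinearMap.ker A = Submodule.span ℝ (Set.range (linkedSequence lead tail)))
    (hnonneg : ∀ x ∈ K, ∀ k, 0 ≤ ⟪lead k, x⟫)
    (hzero : ∀ x ∈ K, ∀ k, ⟪lead k, x⟫ = 0 → ⟪tail k, x⟫ = 0)
    (htest : ∀ (k : Fin N) (M : ℝ), ∃ x ∈ K, ⟪lead k, x⟫ = 1 ∧ ⟪tail k, x⟫ = M ∧
      ∀ i : Fin N, (i : ℕ) < k ∨ (i : ℕ) = k + 1 → ⟪lead i, x⟫ = 0) :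
    singularityDegree K 0 A = N := by
  refine singularityDegree_eq_of_chain hker (fun k x hx h => ?_) fun k M => ?_
  · rw [inner_linkedSequence fun i hi => hzero x hx i (inner_lead_eq_zero hzero hx h i hi)]
    exact hnonneg x hx k
  · obtain ⟨x, hx, h1, hM, h0⟩ := htest k M
    have htail : ∀ i < k, ⟪tail i, x⟫ = 0 := fun i hi => hzero x hx i (h0 i (Or.inl hi))
    refine ⟨x, hx, fun i hi => ?_, ?_, fun l hl => ?_⟩
    · rw [inner_linkedSequence fun l hl => htail l (hl.trans hi), h0 i (Or.inl hi)]
    · rw [inner_linkedSequence htail, h1]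
    · rw [linkedSequence_of_eq_add_one hl, inner_add_left, h0 l (Or.inr hl), hM, zero_add]

end LinkedSequence

/-! ### Enumeration of the generators of `𝓛^⊥` -/

section Generators

variable {r₁ r₂ : ℕ}

/-- The number of generators in the matrix blocks before the block `j`. -/
def blockOffset (n : Fin r₂ → ℕ) (j : Fin r₂) : ℕ := ∑ i : Fin j, (n (Fin.castLE j.2.le i) - 1)

theorem blockOffset_eq_zero {n : Fin r₂ → ℕ} {j : Fin r₂} (hj : (j : ℕ) = 0) :
    blockOffset n j = 0 := by
  obtain ⟨j, hjr⟩ := j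
  subst hj
  rfl

theorem blockOffset_of_eq_add_one {n : Fin r₂ → ℕ} {j l : Fin r₂} (hjl : (j : ℕ) + 1 = l) :
    blockOffset n l = blockOffset n j + (n j - 1) := by
  obtain ⟨l, hl⟩ := l
  subst hjl
  exact Fin.sum_univ_castSucc _

/-- The generators are numbered by the Lorentz blocks, and by the leading diagonal positions
`1, …, n_j - 1` in the matrix blocks. -/
abbrev GeneratorIndex (r₁ : ℕ) {r₂ : ℕ} (n : Fin r₂ → ℕ) : Type :=
  Fin r₁ ⊕ (j : Fin r₂) × Fin (n j - 1)

/-- The place of a generator in the order of the facial reduction. -/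
def generatorPlace (r₁ : ℕ) {r₂ : ℕ} (n : Fin r₂ → ℕ) :
    GeneratorIndex r₁ n ≃ Fin (r₁ + ∑ j, (n j - 1)) :=
  (Equiv.sumCongr (Equiv.refl _) finSigmaFinEquiv).trans finSumFinEquiv

theorem generatorPlace_inl (n : Fin r₂ → ℕ) (j : Fin r₁) :
    (generatorPlace r₁ n (.inl j) : ℕ) = j := by
  simp [generatorPlace]

theorem generatorPlace_inr (n : Fin r₂ → ℕ) (j : Fin r₂) (p : Fin (n j - 1)) :
    (generatorPlace r₁ n (.inr ⟨j, p⟩) : ℕ) = r₁ + (blockOffset n j + p) := by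
  simp [generatorPlace, finSigmaFinEquiv_apply, blockOffset]

/-- The part of a generator inside its own block. -/
def leadElt (t : Fin r₁ → ℕ) (n : Fin r₂ → ℕ) : GeneratorIndex r₁ n → ProductSpace t n
  | .inl j => lorentzElt t n j 1 + lorentzElt t n j 2
  | .inr ⟨j, p⟩ => psdElt t n j (p + 1) (p + 1)

/-- The summand in the same block as `leadElt t n i` that belongs to the next generator. -/
def tailElt (t : Fin r₁ → ℕ) (n : Fin r₂ → ℕ) : GeneratorIndex r₁ n → ProductSpace t n
  | .inl j => lorentzElt t n j 3
  | .inr ⟨j, p⟩ =>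
    if (p : ℕ) + 2 < n j then psdElt t n j (p + 1) (p + 3) else psdElt t n j (n j) (n j - 1)

variable {t : Fin r₁ → ℕ} {n : Fin r₂ → ℕ}

/-- With the next lemma, this identifies the generators with the linked sequence. The tail at the
end of a block is attached to the first lead of the following block. -/
theorem isGenerator_leadElt_or (hn : ∀ j, 3 ≤ n j) (l : GeneratorIndex r₁ n) :
    ((generatorPlace r₁ n l : ℕ) = 0 ∧ IsGenerator t n (leadElt t n l)) ∨
      ∃ i, (generatorPlace r₁ n l : ℕ) = generatorPlace r₁ n i + 1 ∧
        IsGenerator t n (leadElt t n l + tailElt t n i) := by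
  rcases l with ⟨_ | l, hl⟩ | ⟨l, _ | p, hp⟩
  · exact Or.inl ⟨by simp [generatorPlace_inl], .lorentz_first _ rfl⟩
  · refine Or.inr ⟨.inl ⟨l, by omega⟩, by simp [generatorPlace_inl], ?_⟩
    rw [add_comm]
    exact .lorentz_next _ _ rfl
  · rcases hl : (l : ℕ) with _ | j
    · rcases r₁ with _ | r
      · refine Or.inl ⟨?_, .psd_first _ hl rfl⟩
        simp [generatorPlace_inr, blockOffset_eq_zero hl]
      · refine Or.inr ⟨.inl (Fin.last r), ?_, ?_⟩
        · simp [generatorPlace_inr, generatorPlace_inl, blockOffset_eq_zero hl]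
        · rw [add_comm (leadElt t n _)]
          exact .lorentz_psd _ _ rfl hl
    · have hj : j < r₂ := by omega
      have hnj := hn ⟨j, hj⟩
      refine Or.inr ⟨.inr ⟨⟨j, hj⟩, ⟨n ⟨j, hj⟩ - 2, by omega⟩⟩, ?_, ?_⟩
      · rw [generatorPlace_inr, generatorPlace_inr,
          blockOffset_of_eq_add_one (j := ⟨j, hj⟩) (l := l) hl.symm]
        simp only
        omega
      · rw [add_comm, tailElt, if_neg (by simp only; omega)]
        exact .psd_next _ _ hl.symm
  · refine Or.inr ⟨.inr ⟨l, ⟨p, by omega⟩⟩, ?_, ?_⟩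
    · simp only [generatorPlace_inr]
      omega
    · rw [tailElt, if_pos (by simp only; omega)]
      exact .psd_inner l (p + 2) (by omega) (by omega)

theorem exists_leadElt_of_isGenerator (hn : ∀ j, 3 ≤ n j) {v : ProductSpace t n}
    (hv : IsGenerator t n v) :
    (∃ l, (generatorPlace r₁ n l : ℕ) = 0 ∧ v = leadElt t n l) ∨
      ∃ i l, (generatorPlace r₁ n l : ℕ) = generatorPlace r₁ n i + 1 ∧
        v = leadElt t n l + tailElt t n i := by
  cases hv with
  | lorentz_first j hj => exact Or.inl ⟨.inl j, by simp [generatorPlace_inl, hj], rfl⟩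
  | lorentz_next j l hjl =>
    exact Or.inr ⟨.inl j, .inl l, by simp [generatorPlace_inl, hjl], add_comm _ _⟩
  | psd_first j hj hr =>
    refine Or.inl ⟨.inr ⟨j, ⟨0, by have := hn j; omega⟩⟩, ?_, rfl⟩
    simp [generatorPlace_inr, blockOffset_eq_zero hj, hr]
  | lorentz_psd j l hj hl =>
    refine Or.inr ⟨.inl j, .inr ⟨l, ⟨0, by have := hn l; omega⟩⟩, ?_, add_comm _ _⟩
    simp [generatorPlace_inr, generatorPlace_inl, blockOffset_eq_zero hl, hj]
  | psd_next j l hjl =>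
    have hnj := hn j
    refine Or.inr ⟨.inr ⟨j, ⟨n j - 2, by omega⟩⟩,
      .inr ⟨l, ⟨0, by have := hn l; omega⟩⟩, ?_, ?_⟩
    · rw [generatorPlace_inr, generatorPlace_inr, blockOffset_of_eq_add_one hjl]
      simp only
      omega
    · rw [add_comm, tailElt, if_neg (by simp only; omega)]
      rfl
  | psd_inner j i hi hin =>
    obtain ⟨p, rfl⟩ : ∃ p, i = p + 2 := ⟨i - 2, by omega⟩
    refine Or.inr ⟨.inr ⟨j, ⟨p, by omega⟩⟩, .inr ⟨j, ⟨p + 1, by omega⟩⟩, ?_, ?_⟩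
    · simp only [generatorPlace_inr]
      omega
    · rw [tailElt, if_pos (by simp only; omega)]
      rfl

theorem isGenerator_eq_range (hn : ∀ j, 3 ≤ n j) : {v | IsGenerator t n v} =
    Set.range (linkedSequence (leadElt t n ∘ (generatorPlace r₁ n).symm)
      (tailElt t n ∘ (generatorPlace r₁ n).symm)) := by
  ext v
  constructor
  · intro hv
    rcases exists_leadElt_of_isGenerator hn hv with ⟨l, hl, rfl⟩ | ⟨i, l, hil, rfl⟩
    · exact ⟨generatorPlace r₁ n l, by rw [linkedSequence_of_eq_zero hl]; simp⟩
    · exact ⟨generatorPlace r₁ n l, by rw [linkedSequence_of_eq_add_one hil]; simp⟩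
  · rintro ⟨k, rfl⟩
    obtain ⟨l, rfl⟩ := (generatorPlace r₁ n).surjective k
    rcases isGenerator_leadElt_or (t := t) hn l with ⟨hl, h⟩ | ⟨i, hil, h⟩
    · rw [linkedSequence_of_eq_zero hl]
      simpa using h
    · rw [linkedSequence_of_eq_add_one hil]
      simpa using h

end Generators

/-! ### The product cone: leads, tails and test points -/

section ProductCone

variable {r₁ r₂ : ℕ} {t : Fin r₁ → ℕ} {n : Fin r₂ → ℕ}

theorem inner_lorentzElt (j : Fin r₁) (i : ℕ) (x : ProductSpace t n) :
    ⟪lorentzElt t n j i, x⟫ = ⟪lorentzUnit (t j) i, x.vec j⟫ := by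
  rw [ProductSpace.inner_eq, Finset.sum_eq_single_of_mem j (Finset.mem_univ _)]
  · simp [lorentzElt, ProductSpace.mk, ProductSpace.vec, ProductSpace.mat]
  · intro l _ hl
    simp [lorentzElt, ProductSpace.mk, ProductSpace.vec, hl]

theorem inner_psdElt (j : Fin r₂) (i k : ℕ) (x : ProductSpace t n) :
    ⟪psdElt t n j i k, x⟫ = ⟪symUnit (n j) i k, x.mat j⟫ := by
  rw [ProductSpace.inner_eq, Finset.sum_eq_single_of_mem (s := Finset.univ (α := Fin r₂)) j
    (Finset.mem_univ _)]
  · simp [psdElt, ProductSpace.mk, ProductSpace.vec, ProductSpace.mat]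
  · intro l _ hl
    simp [psdElt, ProductSpace.mk, ProductSpace.mat, hl]

theorem inner_symUnit_self {k i : ℕ} {p : Fin k} (hp : (p : ℕ) + 1 = i) (X : SymSpace k) :
    ⟪symUnit k i i, X⟫ = X.toMatrix p p := by
  rw [Submodule.coe_inner, PiLp.inner_apply, Finset.sum_eq_single_of_mem (p, p) (Finset.mem_univ _)]
  · simp [symUnit, hp, SymSpace.toMatrix]
  · rintro ⟨a, b⟩ _ hab
    have : ¬ ((a : ℕ) + 1 = i ∧ (b : ℕ) + 1 = i) := fun h =>
      hab (Prod.ext (Fin.ext (by simp only; omega)) (Fin.ext (by simp only; omega)))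
    simp [symUnit, this]

theorem inner_symUnit_of_ne {k i l : ℕ} {p q : Fin k} (hp : (p : ℕ) + 1 = i) (hq : (q : ℕ) + 1 = l)
    (hpq : p ≠ q) (X : SymSpace k) : ⟪symUnit k i l, X⟫ = 2 * X.toMatrix p q := by
  have hne : (p, q) ≠ (q, p) := fun h => hpq (congrArg Prod.fst h)
  have hX : X.toMatrix q p = X.toMatrix p q := X.2 q p
  rw [Submodule.coe_inner, PiLp.inner_apply, Finset.sum_eq_add (p, q) (q, p) hne]
  · refine Eq.trans (congrArg₂ (· + ·) ?_ (Eq.trans ?_ hX)) (two_mul _).symm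
    · simp [symUnit, hp, hq, SymSpace.toMatrix]
    · simp [symUnit, hp, hq, SymSpace.toMatrix]
  · rintro ⟨a, b⟩ _ ⟨h1, h2⟩
    have : ¬ (((a : ℕ) + 1 = i ∧ (b : ℕ) + 1 = l) ∨ ((a : ℕ) + 1 = l ∧ (b : ℕ) + 1 = i)) := by
      rintro (h | h)
      · exact h1 (Prod.ext (Fin.ext (by simp only; omega)) (Fin.ext (by simp only; omega)))
      · exact h2 (Prod.ext (Fin.ext (by simp only; omega)) (Fin.ext (by simp only; omega)))
    simp [symUnit, this]
  · simp
  · simp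

theorem inner_leadElt_inl (ht : ∀ j, 3 ≤ t j) (j : Fin r₁) (x : ProductSpace t n) :
    ⟪leadElt t n (.inl j), x⟫ =
      (x.vec j).fst + (x.vec j).snd ⟨0, by have := ht j; omega⟩ := by
  rw [leadElt, inner_add_left, inner_lorentzElt, inner_lorentzElt, inner_lorentzUnit_one,
    inner_lorentzUnit_add_two (k := 0)]

theorem inner_tailElt_inl (ht : ∀ j, 3 ≤ t j) (j : Fin r₁) (x : ProductSpace t n) :
    ⟪tailElt t n (.inl j), x⟫ = (x.vec j).snd ⟨1, by have := ht j; omega⟩ := by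
  rw [tailElt, inner_lorentzElt, inner_lorentzUnit_add_two (k := 1)]

theorem inner_leadElt_inr (j : Fin r₂) (p : Fin (n j - 1)) (x : ProductSpace t n) :
    ⟪leadElt t n (.inr ⟨j, p⟩), x⟫ =
      (x.mat j).toMatrix ⟨p, by omega⟩ ⟨p, by omega⟩ := by
  rw [leadElt, inner_psdElt]
  exact inner_symUnit_self (p := ⟨p, by omega⟩) rfl _

/-- The column of the entry paired with `tailElt`. -/
def tailColumn {k : ℕ} (p : Fin (k - 1)) : Fin k :=
  if h : (p : ℕ) + 2 < k then ⟨p + 2, h⟩ else ⟨p + 1, by omega⟩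

theorem lt_tailColumn {k : ℕ} (p : Fin (k - 1)) : (p : ℕ) < tailColumn p := by
  unfold tailColumn
  split_ifs <;> simp

/-- The test point for `p` has a second nonzero diagonal entry at the tail column. That entry must
not be a lead required to vanish: it is `p + 2`, or the last position, which is no lead. -/
theorem ne_tailColumn {k : ℕ} (p q : Fin (k - 1)) (h : (q : ℕ) < p ∨ (q : ℕ) = p + 1) :
    (q : ℕ) ≠ tailColumn p := by
  unfold tailColumn
  split_ifs <;> simp only <;> omega

theorem inner_tailElt_inr (j : Fin r₂) (p : Fin (n j - 1)) (x : ProductSpace t n) :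
    ⟪tailElt t n (.inr ⟨j, p⟩), x⟫ = 2 * (x.mat j).toMatrix ⟨p, by omega⟩ (tailColumn p) := by
  have hlt := lt_tailColumn p
  rw [tailElt]
  split_ifs with h
  · rw [inner_psdElt, inner_symUnit_of_ne (p := ⟨p, by omega⟩) (q := tailColumn p) rfl
      (by simp [tailColumn, h])]
    exact fun h => hlt.ne (congrArg Fin.val h)
  · rw [inner_psdElt, inner_symUnit_of_ne (p := tailColumn p) (q := ⟨p, by omega⟩)
      (by simp only [tailColumn, h, dite_false]; omega) (by simp only; omega)]
    · congr 1
      exact (x.mat j).2 _ _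
    · exact fun h => hlt.ne' (congrArg Fin.val h)

theorem inner_leadElt_nonneg (ht : ∀ j, 3 ≤ t j) {x : ProductSpace t n} (hx : x ∈ productCone t n)
    (i : GeneratorIndex r₁ n) : 0 ≤ ⟪leadElt t n i, x⟫ := by
  rcases i with j | ⟨j, p⟩
  · rw [inner_leadElt_inl ht]
    have h1 : ‖(x.vec j).snd‖ ≤ (x.vec j).fst := hx.1 j
    have h2 := PiLp.norm_apply_le (x.vec j).snd ⟨0, by have := ht j; omega⟩
    rw [Real.norm_eq_abs] at h2
    have h3 := neg_abs_le ((x.vec j).snd ⟨0, by have := ht j; omega⟩)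
    linarith
  · rw [inner_leadElt_inr]
    exact diag_nonneg_of_mem_psdCone (hx.2 j) _

theorem inner_tailElt_eq_zero (ht : ∀ j, 3 ≤ t j) {x : ProductSpace t n}
    (hx : x ∈ productCone t n) (i : GeneratorIndex r₁ n) (h : ⟪leadElt t n i, x⟫ = 0) :
    ⟪tailElt t n i, x⟫ = 0 := by
  rcases i with j | ⟨j, p⟩
  · rw [inner_leadElt_inl ht] at h
    rw [inner_tailElt_inl ht]
    have h1 : ‖(x.vec j).snd‖ ≤ (x.vec j).fst := hx.1 j
    have h2 : ‖(x.vec j).snd‖ ^ 2 ≤ (x.vec j).fst ^ 2 := by gcongr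
    rw [EuclideanSpace.norm_sq_eq] at h2
    have h01 : (⟨0, by have := ht j; omega⟩ : Fin (t j - 1)) ≠ ⟨1, by have := ht j; omega⟩ := by simp
    have h3 := Finset.add_le_sum (f := fun k => ‖(x.vec j).snd k‖ ^ 2) (fun k _ => by positivity)
      (Finset.mem_univ _) (Finset.mem_univ _) h01
    simp only [Real.norm_eq_abs, sq_abs] at h2 h3
    -- With `x₁ = -x₀`, the inequality `x₁² + x₂² ≤ x₀²` leaves only `x₂ = 0`.
    have h4 := eq_neg_of_add_eq_zero_right h
    rw [h4] at h3
    exact pow_eq_zero_iff two_ne_zero |>.1 (le_antisymm (by linarith) (sq_nonneg _))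
  · rw [inner_leadElt_inr] at h
    rw [inner_tailElt_inr, entry_eq_zero_of_mem_psdCone (hx.2 j) h, mul_zero]

theorem exists_inner_leadElt_eq_one (ht : ∀ j, 3 ≤ t j) (k : GeneratorIndex r₁ n) (M : ℝ) :
    ∃ x ∈ productCone t n, ⟪leadElt t n k, x⟫ = 1 ∧ ⟪tailElt t n k, x⟫ = M ∧
      ∀ i, (generatorPlace r₁ n i : ℕ) < generatorPlace r₁ n k ∨
        (generatorPlace r₁ n i : ℕ) = generatorPlace r₁ n k + 1 → ⟪leadElt t n i, x⟫ = 0 := by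
  rcases k with j | ⟨j, p⟩
  -- The first two coordinates have sum 1 and difference `M²`, so `x₀² - x₁² = M²` and the point is
  -- on the boundary.
  · let v : LorentzSpace (t j) := lorentzPoint (t j) ((1 + M ^ 2) / 2) ((1 - M ^ 2) / 2) M
    have hv : v ∈ lorentzCone (t j) :=
      (lorentzPoint_mem_iff (ht j)).2 ⟨by positivity, le_of_eq (by ring)⟩
    let x : ProductSpace t n := ProductSpace.mk (Pi.single j v) 0
    have hxj : x.vec j = v := by simp [x, ProductSpace.vec, ProductSpace.mk]
    have hxl : ∀ l, l ≠ j → x.vec l = 0 := fun l hl => by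
      simp [x, ProductSpace.vec, ProductSpace.mk, hl]
    have hxm : ∀ l, x.mat l = 0 := fun l => rfl
    refine ⟨x, ⟨fun l => ?_, fun l => zero_mem _⟩, ?_, ?_, fun i hi => ?_⟩
    · rcases eq_or_ne l j with rfl | hl
      · rw [hxj]; exact hv
      · rw [hxl l hl]; exact zero_mem _
    · rw [inner_leadElt_inl ht, hxj, lorentzPoint_fst, lorentzPoint_snd]
      simp only [if_true]
      ring
    · rw [inner_tailElt_inl ht, hxj, lorentzPoint_snd]
      simp
    · rcases i with l | ⟨l, q⟩
      · have hl : l ≠ j := by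
          rintro rfl
          omega
        rw [inner_leadElt_inl ht, hxl l hl]
        simp
      · rw [inner_leadElt_inr, hxm]
        rfl
  -- The matrix `v vᵀ` has off-diagonal entry `M / 2`, which the tail counts twice.
  · let v : Fin (n j) → ℝ := Pi.single ⟨p, by omega⟩ 1 + Pi.single (tailColumn p) (M / 2)
    have hlt := lt_tailColumn p
    have hvp : v ⟨p, by omega⟩ = 1 := by
      have : (⟨p, by omega⟩ : Fin (n j)) ≠ tailColumn p := fun h => hlt.ne (congrArg Fin.val h)
      simp [v, this]
    have hvq : v (tailColumn p) = M / 2 := by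
      have : tailColumn p ≠ (⟨p, by omega⟩ : Fin (n j)) := fun h => hlt.ne' (congrArg Fin.val h)
      simp [v, this]
    let x : ProductSpace t n := ProductSpace.mk 0 (Pi.single j (symOuter v))
    have hxj : x.mat j = symOuter v := by simp [x, ProductSpace.mat, ProductSpace.mk]
    have hxl : ∀ l, l ≠ j → x.mat l = 0 := fun l hl => by
      simp [x, ProductSpace.mat, ProductSpace.mk, hl]
    have hxv : ∀ l, x.vec l = 0 := fun l => rfl
    refine ⟨x, ⟨fun l => zero_mem _, fun l => ?_⟩, ?_, ?_, fun i hi => ?_⟩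
    · rcases eq_or_ne l j with rfl | hl
      · rw [hxj]; exact symOuter_mem_psdCone v
      · rw [hxl l hl]; exact zero_mem _
    · rw [inner_leadElt_inr, hxj, symOuter_toMatrix, hvp, one_mul]
    · rw [inner_tailElt_inr, hxj, symOuter_toMatrix, hvp, hvq]
      ring
    · rcases i with l | ⟨l, q⟩
      · rw [inner_leadElt_inl ht, hxv]
        simp
      · rw [inner_leadElt_inr]
        rcases eq_or_ne l j with rfl | hl
        · rw [generatorPlace_inr, generatorPlace_inr] at hi
          have hq : (q : ℕ) < p ∨ (q : ℕ) = p + 1 := by omega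
          have h1 : (⟨q, by omega⟩ : Fin (n l)) ≠ ⟨p, by omega⟩ := fun h => by
            have := congrArg Fin.val h
            simp only at this
            omega
          have h2 : (⟨q, by omega⟩ : Fin (n l)) ≠ tailColumn p := fun h =>
            ne_tailColumn p q hq (congrArg Fin.val h)
          rw [hxj, symOuter_toMatrix]
          simp [v, h1, h2]
        · rw [hxl l hl]
          rfl

/-- The kernel of `A` is the orthogonal complement of the range of its adjoint, and double
complements cancel in finite dimension. -/
theorem ker_eq_worstLPerp {m : ℕ} {A : ProductSpace t n →ₗ[ℝ] EuclideanSpace ℝ (Fin m)}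
    (hA : LinearMap.range (LinearMap.adjoint A) = worstL t n) : LinearMap.ker A = worstLPerp t n := by
  rw [← Submodule.orthogonal_orthogonal (LinearMap.ker A), LinearMap.orthogonal_ker, hA, worstL,
    Submodule.orthogonal_orthogonal]

theorem singularityDegree_productCone (ht : ∀ j, 3 ≤ t j) (hn : ∀ j, 3 ≤ n j) {m : ℕ}
    {A : ProductSpace t n →ₗ[ℝ] EuclideanSpace ℝ (Fin m)}
    (hA : LinearMap.range (LinearMap.adjoint A) = worstL t n) :
    singularityDegree (productCone t n) 0 A = ((r₁ + ∑ j, (n j - 1) : ℕ) : ℕ∞) := by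
  refine singularityDegree_eq_of_linkedSequence (lead := leadElt t n ∘ (generatorPlace r₁ n).symm)
    (tail := tailElt t n ∘ (generatorPlace r₁ n).symm) ?_
    (fun x hx k => inner_leadElt_nonneg ht hx _) (fun x hx k => inner_tailElt_eq_zero ht hx _)
    fun k M => ?_
  · rw [ker_eq_worstLPerp hA, worstLPerp, isGenerator_eq_range hn]
  · obtain ⟨k, rfl⟩ := (generatorPlace r₁ n).surjective k
    obtain ⟨x, hx, h1, hM, h0⟩ := exists_inner_leadElt_eq_one (t := t) ht k M
    refine ⟨x, hx, by simpa using h1, by simpa using hM, fun i hi => h0 _ ?_⟩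
    simpa using hi

theorem facialReductionBound_eq (ht : ∀ j, 3 ≤ t j) (hn : ∀ j, 3 ≤ n j) :
    facialReductionBound t n = ((r₁ + ∑ j, (n j - 1) : ℕ) : ℕ∞) + 1 := by
  rw [facialReductionBound, Finset.sum_congr rfl fun j _ => distPoly_lorentzCone (ht j),
    Finset.sum_congr rfl fun j _ => distPoly_psdCone (n := n j) (by have := hn j; omega), add_comm]
  simp

end ProductCone


end

theorem mainTheorem10 {r₁ r₂ : ℕ} (hr : 0 < r₁ + r₂) (t : Fin r₁ → ℕ) (n : Fin r₂ → ℕ)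
    (ht : ∀ j, 3 ≤ t j) (hn : ∀ j, 3 ≤ n j)
    (m : ℕ) (A : ProductSpace t n →ₗ[ℝ] EuclideanSpace ℝ (Fin m))
    (hA : LinearMap.range (LinearMap.adjoint A) = worstL t n) :
    singularityDegree (productCone t n) 0 A = ((r₁ + ∑ j, (n j - 1) : ℕ) : ℕ∞) ∧
      facialReductionBound t n = singularityDegree (productCone t n) 0 A + 1 := by
  rw [facialReductionBound_eq ht hn, singularityDegree_productCone ht hn hA]
  exact ⟨rfl, rfl⟩
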